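/- Let $A$ be a finite-dimensional complex Hilbert space of dimension $|A|$ with a fixed orthonormal basis $\{|i\rangle\}$, and let $B, A'$ be copies of $A$. Write $\mathfrak B(X)$ for the operators on $X$, $\mathfrak L(X,Y)$ for the linear maps $\mathfrak B(X)\to\mathfrak B(Y)$, and $M^T$ for the transpose of $M$ in the fixed basis. A quantum state is a positive semidefinite operator of trace one; a quantum channel is a completely positive trace-preserving linear map. Let $\phi^+=|A|^{-1}\sum_{i,j}|ii\rangle\langle jj|$, and for $\mathcal N\in\mathfrak L(A,A)$ let $J^{\mathcal N}=(\mathcal N\otimes\mathrm{id})(\phi^+)$ be its Choi matrix. For an operator $W$ on $A\otimes A$ the generalized transposition $\mathfrak T[W]$ is the linear map $\mathfrak L(A,A)\to\mathfrak L(A,A)$ given by $$\mathfrak T[W](\mathcal N)(\rho)=|A|^2\,\mathrm{Tr}_{BA'}\big[(\mathbb 1_A\otimes\phi^+_{BA'})\,(W J^{\mathcal N}_{AB}W^\dagger\otimes\rho_{A'})\big].$$ A superchannel is a linear map $\Theta:\mathfrak L(X_0,X_1)\to\mathfrak L(Y_0,Y_1)$ that maps quantum channels to quantum channels even when it acts on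 a part of a multipartite channel: for all finite-dimensional $R_0,R_1$, the map $\Theta\otimes\mathrm{id}_{\mathfrak L(R_0,R_1)}$ sends every channel from $X_0\otimes R_0$ to $X_1\otimes R_1$ to a channel from $Y_0\otimes R_0$ to $Y_1\otimes R_1$. For a quantum state $\sigma$ on $A$, the state preparation superchannel is $\mathfrak P^\sigma:\mathfrak L(A,A)\to\mathfrak L(\mathbb C,A)$, $\mathfrak P^\sigma(\mathcal N)=\mathcal N(\sigma)$, where an operator $K\in\mathfrak B(A)$ is identified with the map $c\mapsto cK$ in $\mathfrak L(\mathbb C,A)$. **Proposition.** Let $W$ be a unitary operator on $A\otimes A'$ and let $\sigma$ be a quantum state on $A$. Then $\mathfrak P^\sigma\circ\mathfrak T[W^\dagger]$ is a superchannel if and only if there exists a quantum state $\tau$ on $A$ such that $$W(\mathbb 1_A\otimes\sigma_{A'}^T)=(\mathbb 1_A\otimes\tau_{A'}^T)W .$$ Moreover, every quantum state $\tau$ satisfying this equation is unitarily similar to $\sigma$, i.e. $\tau=U\sigma U^\dagger$ for some unitary operator $U$ on $A$. -/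

import Mathlib

open scoped Matrix Kronecker ComplexOrder

namespace QuantumTime

noncomputable section

/-- `𝔅(X)`: operators on the finite-dimensional quantum system with fixed orthonormal basis
indexed by `X`. The system `X ⊗ Y` is indexed by `X × Y`, the trivial system by `Unit`. -/
abbrev Op (X : Type*) := Matrix X X ℂ

/-- `𝔏(X, Y)`: linear maps from `𝔅(X)` to `𝔅(Y)`. -/
abbrev LMap (X Y : Type*) := Op X →ₗ[ℂ] Op Y

/-- Supermaps: linear maps from `𝔏(X₀, X₁)` to `𝔏(Y₀, Y₁)`. -/
abbrev SMap (X₀ X₁ Y₀ Y₁ : Type*) := LMap X₀ X₁ →ₗ[ℂ] LMap Y₀ Y₁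

/-- Quantum states: positive semidefinite operators of trace one. -/
def IsState {X : Type*} [Fintype X] (ρ : Op X) : Prop :=
  ρ.PosSemidef ∧ ρ.trace = 1

/-- The `(r, r')` block, an operator on `X`, of an operator on `X ⊗ R`. -/
def block {X R : Type*} (r r' : R) : Op (X × R) →ₗ[ℂ] Op X where
  toFun ω := Matrix.of fun x x' => ω (x, r) (x', r')
  map_add' _ _ := rfl
  map_smul' _ _ := rfl

/-- `Φ ⊗ id_R : 𝔅(X ⊗ R) → 𝔅(Y ⊗ R)`. -/
def LMap.tensorId {X Y : Type*} (R : Type*) (Φ : LMap X Y) : LMap (X × R) (Y × R) where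
  toFun ω := Matrix.of fun p q => Φ (block p.2 q.2 ω) p.1 q.1
  map_add' _ _ := by ext; simp
  map_smul' _ _ := by ext; simp

/-- Complete positivity: `Φ ⊗ id` preserves positive semidefiniteness for every finite-dimensional
ancilla. -/
def IsCompletelyPositive {X Y : Type*} (Φ : LMap X Y) : Prop :=
  ∀ (k : ℕ) (ω : Op (X × Fin k)), ω.PosSemidef → (LMap.tensorId (Fin k) Φ ω).PosSemidef

/-- Quantum channels: completely positive trace-preserving linear maps. -/
def IsChannel {X Y : Type*} [Fintype X] [Fintype Y] (Φ : LMap X Y) : Prop :=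
  IsCompletelyPositive Φ ∧ ∀ ρ : Op X, (Φ ρ).trace = ρ.trace

/-- The component in `𝔏(X₀, X₁)` of `𝒩 ∈ 𝔏(X₀ ⊗ R₀, X₁ ⊗ R₁)` at the matrix unit
`|r⟩⟨r'|` on the input `R₀` and the matrix entry `(s, s')` on the output `R₁`, that is,
`ρ ↦ (1 ⊗ ⟨s|) 𝒩(ρ ⊗ |r⟩⟨r'|) (1 ⊗ |s'⟩)`. -/
def LMap.component {X₀ X₁ R₀ R₁ : Type*} [DecidableEq R₀]
    (N : LMap (X₀ × R₀) (X₁ × R₁)) (r r' : R₀) (s s' : R₁) : LMap X₀ X₁ where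
  toFun ρ := block s s' (N (ρ ⊗ₖ Matrix.single r r' (1 : ℂ)))
  map_add' _ _ := by simp [Matrix.add_kronecker]
  map_smul' _ _ := by simp [Matrix.smul_kronecker]

/-- `Θ ⊗ 𝔦𝔡`, the action of the supermap `Θ` on a part of a multipartite map: the linear extension
of `𝒩 ⊗ 𝒦 ↦ Θ(𝒩) ⊗ 𝒦`, obtained by applying `Θ` to every component of a map
in `𝔏(X₀ ⊗ R₀, X₁ ⊗ R₁)`. -/
def SMap.onPart {X₀ X₁ Y₀ Y₁ R₀ R₁ : Type*} [Fintype R₀] [DecidableEq R₀]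
    (Θ : SMap X₀ X₁ Y₀ Y₁) (N : LMap (X₀ × R₀) (X₁ × R₁)) :
    LMap (Y₀ × R₀) (Y₁ × R₁) where
  toFun ω := Matrix.of fun p q =>
    ∑ r : R₀, ∑ r' : R₀, Θ (N.component r r' p.2 q.2) (block r r' ω) p.1 q.1
  map_add' _ _ := by ext; simp [Finset.sum_add_distrib]
  map_smul' _ _ := by ext; simp [Finset.mul_sum]

/-- Superchannels: supermaps which send quantum channels to quantum channels, even when they act
only on a part of a multipartite quantum channel. -/
def IsSuperchannel {X₀ X₁ Y₀ Y₁ : Type*} [Fintype X₀] [Fintype X₁] [Fintype Y₀] [Fintype Y₁]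
    (Θ : SMap X₀ X₁ Y₀ Y₁) : Prop :=
  ∀ (m n : ℕ) (N : LMap (X₀ × Fin m) (X₁ × Fin n)), IsChannel N → IsChannel (Θ.onPart N)

/-- The maximally entangled state `φ⁺ = |X|⁻¹ ∑ᵢⱼ |ii⟩⟨jj|` on `X ⊗ X'`. -/
def maxEntangled (X : Type*) [Fintype X] [DecidableEq X] : Op (X × X) :=
  Matrix.of fun p q => if p.1 = p.2 ∧ q.1 = q.2 then (Fintype.card X : ℂ)⁻¹ else 0

/-- The Choi matrix `J^𝒩 = (𝒩 ⊗ id)(φ⁺)`. -/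
def choi {X : Type*} [Fintype X] [DecidableEq X] : LMap X X →ₗ[ℂ] Op (X × X) where
  toFun N := LMap.tensorId X N (maxEntangled X)
  map_add' _ _ := rfl
  map_smul' _ _ := rfl

/-- The partial trace over the second tensor factor. -/
def partialTrace {X Y : Type*} [Fintype Y] : Op (X × Y) →ₗ[ℂ] Op X where
  toFun M := Matrix.of fun x x' => ∑ y, M (x, y) (x', y)
  map_add' _ _ := by ext; simp [Finset.sum_add_distrib]
  map_smul' _ _ := by ext; simp [Finset.mul_sum]

/-- The operator `(1_A ⊗ φ⁺_{BA'}) (K_{AB} ⊗ ρ_{A'})` on `A ⊗ (B ⊗ A') ≅ (A ⊗ B) ⊗ A'`. -/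
def contractWith {A : Type*} [Fintype A] [DecidableEq A] (K : Op (A × A)) (ρ : Op A) :
    Op (A × (A × A)) :=
  ((1 : Op A) ⊗ₖ maxEntangled A) *
    Matrix.reindex (Equiv.prodAssoc A A A) (Equiv.prodAssoc A A A) (K ⊗ₖ ρ)

/-- The generalized transposition as a supermap:
`𝔗[W](𝒩)(ρ) = |A|² Tr_{BA'}[(1_A ⊗ φ⁺_{BA'}) (W J^𝒩_{AB} W† ⊗ ρ_{A'})]`,
where `B` and `A'` are copies of `A`. -/
def genTransposition {A : Type*} [Fintype A] [DecidableEq A] (W : Op (A × A)) :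
    SMap A A A A where
  toFun N :=
    { toFun := fun ρ =>
        ((Fintype.card A : ℂ) ^ 2) • partialTrace (contractWith (W * choi N * Wᴴ) ρ)
      map_add' := fun ρ ρ' => by
        simp [contractWith, Matrix.kronecker_add, Matrix.submatrix_add, Matrix.mul_add]
      map_smul' := fun c ρ => by
        simp [contractWith, Matrix.kronecker_smul, Matrix.submatrix_smul, smul_comm c] }
  map_add' N N' := by
    ext1 ρ
    simp [contractWith, Matrix.add_kronecker, Matrix.submatrix_add, Matrix.mul_add, Matrix.add_mul]
  map_smul' c N := by
    ext1 ρ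
    simp [contractWith, Matrix.smul_kronecker, Matrix.submatrix_smul, smul_comm c]

/-- The state preparation supermap `𝔓^σ(𝒩) = 𝒩(σ)`, the output operator `𝒩(σ) ∈ 𝔅(A)` being
identified with the map `c ↦ c 𝒩(σ)` in `𝔏(ℂ, A)`. -/
def statePreparation {A : Type*} (σ : Op A) : SMap A A Unit A where
  toFun N :=
    { toFun := fun c => c () () • N σ
      map_add' := by intro c d; simp [add_smul]
      map_smul' := by intro c d; simp [mul_smul] }
  map_add' _ _ := by ext; simp
  map_smul' _ _ := by ext; simp [mul_left_comm]

end

end QuantumTime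

namespace QuantumTime

open Matrix

/-! Everything rests on one trace formula: the trace of `𝔗[W†](𝒩)(σ)` is `Tr(C M)`, where `C` is the
unnormalized Choi matrix of `𝒩` and `M = W(1 ⊗ σᵀ)W†`. Complete positivity is automatic, since `C`
is only conjugated by `W†` and contracted with `σ ≥ 0`. So only trace preservation matters. If `M =
1 ⊗ τᵀ`, then `Tr(C M) = Tr 𝒩(τ)`, and trace preservation passes through componentwise. Conversely,
trivial ancillas give `Tr(C M) = 1` for every Choi matrix `C` of a channel. Measure-and-prepare
channels then force `M = 1 ⊗ T` (`exists_eq_one_kronecker`), and `T` inherits positivity and trace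
one from `M`. For similarity, `1 ⊗ σᵀ` and `1 ⊗ τᵀ` are conjugate, so the characteristic polynomials
of `σ` and `τ` have equal `|A|`-th powers, hence coincide; Hermitian matrices with the same spectrum
are unitarily similar. -/

@[simp]
theorem block_apply {X R : Type*} (r r' : R) (ω : Op (X × R)) (x x' : X) :
    block r r' ω x x' = ω (x, r) (x', r') := rfl

theorem LMap.tensorId_apply {X Y R : Type*} (Φ : LMap X Y) (ω : Op (X × R)) (p q : Y × R) :
    LMap.tensorId R Φ ω p q = Φ (block p.2 q.2 ω) p.1 q.1 := rfl

theorem LMap.component_apply {X₀ X₁ R₀ R₁ : Type*} [DecidableEq R₀]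
    (N : LMap (X₀ × R₀) (X₁ × R₁)) (r r' : R₀) (s s' : R₁) (ρ : Op X₀) (x x' : X₁) :
    N.component r r' s s' ρ x x' = N (ρ ⊗ₖ single r r' (1 : ℂ)) (x, s) (x', s') := rfl

theorem SMap.onPart_apply {X₀ X₁ Y₀ Y₁ R₀ R₁ : Type*} [Fintype R₀] [DecidableEq R₀]
    (Θ : SMap X₀ X₁ Y₀ Y₁) (N : LMap (X₀ × R₀) (X₁ × R₁)) (ω : Op (Y₀ × R₀)) (p q : Y₁ × R₁) :
    Θ.onPart N ω p q =
      ∑ r, ∑ r', Θ (N.component r r' p.2 q.2) (block r r' ω) p.1 q.1 := rfl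

theorem partialTrace_apply {X Y : Type*} [Fintype Y] (M : Op (X × Y)) (x x' : X) :
    partialTrace M x x' = ∑ y, M (x, y) (x', y) := rfl

theorem statePreparation_comp_apply {A : Type*} [Fintype A] (Ψ : SMap A A A A) (σ : Op A)
    (N : LMap A A) (c : Op Unit) (x x' : A) :
    (statePreparation σ ∘ₗ Ψ) N c x x' = c () () * Ψ N σ x x' := rfl

/-! ### Choi matrices and complete positivity -/

/-- The unnormalized Choi matrix `∑ᵢⱼ 𝒩(|i⟩⟨j|) ⊗ |i⟩⟨j|`. -/
def choiMatrix {X Y : Type*} [DecidableEq X] (N : LMap X Y) : Op (Y × X) :=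
  Matrix.of fun p q => N (single p.2 q.2 1) p.1 q.1

/-- The linear map with a given unnormalized Choi matrix. -/
def ofChoiMatrix {X Y : Type*} [Fintype X] (C : Op (Y × X)) : LMap X Y where
  toFun ρ := Matrix.of fun y y' => ∑ x, ∑ x', C (y, x) (y', x') * ρ x x'
  map_add' _ _ := by ext; simp [mul_add, Finset.sum_add_distrib]
  map_smul' c ρ := by ext; simp [Finset.mul_sum, mul_left_comm c]

theorem apply_eq_sum_choiMatrix {X Y : Type*} [Fintype X] [DecidableEq X] (N : LMap X Y)
    (ρ : Op X) (y y' : Y) :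
    N ρ y y' = ∑ x, ∑ x', choiMatrix N (y, x) (y', x') * ρ x x' := by
  conv_lhs => rw [matrix_eq_sum_single ρ]
  simp only [map_sum, Matrix.sum_apply]
  refine Finset.sum_congr rfl fun x _ => Finset.sum_congr rfl fun x' _ => ?_
  have h : single x x' (ρ x x') = ρ x x' • single x x' (1 : ℂ) := by simp
  rw [h, map_smul]
  simp [choiMatrix, mul_comm]

/-- This is `(V ⊗ 1)† Q (V ⊗ 1)` in coordinates, the form in which both complete positivity proofs
present their outputs. -/
theorem posSemidef_compress {I Y Z : Type*} [Fintype I] [Fintype Y] [Fintype Z]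
    [DecidableEq Z]
    {Q : Op (I × Z)} (hQ : Q.PosSemidef) (V : Matrix I Y ℂ) :
    (Matrix.of fun p q : Y × Z =>
      ∑ i, ∑ j, star (V i p.1) * Q (i, p.2) (j, q.2) * V j q.1).PosSemidef := by
  convert hQ.conjTranspose_mul_mul_same (V ⊗ₖ (1 : Op Z)) using 1
  ext ⟨y, z⟩ ⟨y', z'⟩
  simp only [of_apply, mul_apply, conjTranspose_apply, kroneckerMap_apply, Fintype.sum_prod_type,
    one_apply]
  rw [Finset.sum_comm]
  simp [Finset.sum_mul, apply_ite star]

theorem choiMatrix_ofChoiMatrix {X Y : Type*} [Fintype X] [DecidableEq X] (C : Op (Y × X)) :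
    choiMatrix (ofChoiMatrix C) = C := by
  ext ⟨y, x⟩ ⟨y', x'⟩
  simp [choiMatrix, ofChoiMatrix, single_apply, ite_and]

/-- Complete positivity implies positivity of the Choi matrix. -/
theorem IsCompletelyPositive.posSemidef_choiMatrix {X Y : Type*} [Fintype X] [DecidableEq X]
    {N : LMap X Y} (hN : IsCompletelyPositive N) : (choiMatrix N).PosSemidef := by
  let e := Fintype.equivFin X
  -- The unnormalized maximally entangled vector, whose blocks are the matrix units.
  let v : X × Fin (Fintype.card X) → ℂ := fun p => if e p.1 = p.2 then 1 else 0
  convert (hN _ _ (posSemidef_vecMulVec_self_star v)).submatrix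
    (fun p : Y × X => (p.1, e p.2)) using 1
  ext ⟨y, x⟩ ⟨y', x'⟩
  have h : block (e x) (e x') (vecMulVec v (star v)) = single x x' 1 := by
    ext i j
    simp [v, vecMulVec_apply, single_apply, ite_and, eq_comm]
    split_ifs <;> rfl
  simp [choiMatrix, LMap.tensorId_apply, h]

/-- Positivity of the Choi matrix implies complete positivity. -/
theorem isCompletelyPositive_of_posSemidef_choiMatrix {X Y : Type*} [Fintype X] [DecidableEq X]
    [Fintype Y] [DecidableEq Y] {N : LMap X Y} (hN : (choiMatrix N).PosSemidef) :
    IsCompletelyPositive N := by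
  intro k ω hω
  let f : (X × X) × Y × Fin k → (Y × X) × X × Fin k := fun p =>
    ((p.2.1, p.1.1), (p.1.2, p.2.2))
  -- Contracting `choiMatrix N ⊗ ω` with the vector `∑ |xx⟩` recovers `(N ⊗ id)(ω)`.
  let V : Matrix (X × X) Unit ℂ := Matrix.of fun p _ => if p.1 = p.2 then 1 else 0
  convert (posSemidef_compress ((hN.kronecker hω).submatrix f) V).submatrix
    (fun p : Y × Fin k => ((), p)) using 1
  ext ⟨y, s⟩ ⟨y', s'⟩
  simp [LMap.tensorId_apply, V, f, apply_eq_sum_choiMatrix N, Fintype.sum_prod_type, apply_ite star]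

/-! ### Trace formulas for the generalized transposition -/

/-- The prefactor `|A|²` cancels one `|A|⁻¹` from the Choi matrix and one from the contraction with
`φ⁺`. -/
theorem genTransposition_apply_apply {A : Type*} [Fintype A] [DecidableEq A] (W : Op (A × A))
    (N : LMap A A) (ρ : Op A) (y y' : A) :
    genTransposition W N ρ y y' =
      ∑ b, ∑ d, (W * choiMatrix N * Wᴴ) (y, b) (y', d) * ρ b d := by
  have hA : (Fintype.card A : ℂ) ≠ 0 := by
    have : Nonempty A := ⟨y⟩
    exact_mod_cast Fintype.card_ne_zero
  have hb : ∀ b b' : A, block b b' (maxEntangled A) =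
      (Fintype.card A : ℂ)⁻¹ • single b b' (1 : ℂ) := by
    intro b b'
    ext i j
    simp [maxEntangled, single_apply, eq_comm]
  have hc : choi N = (Fintype.card A : ℂ)⁻¹ • choiMatrix N := by
    ext p q
    have h : choi N p q = N (block p.2 q.2 (maxEntangled A)) p.1 q.1 := rfl
    rw [h, hb, map_smul]
    rfl
  have hc' : W * choi N * Wᴴ = (Fintype.card A : ℂ)⁻¹ • (W * choiMatrix N * Wᴴ) := by
    rw [hc]; simp
  have h : genTransposition W N ρ =
      ((Fintype.card A : ℂ) ^ 2) • partialTrace (contractWith (W * choi N * Wᴴ) ρ) := rfl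
  rw [h, hc']
  generalize W * choiMatrix N * Wᴴ = K
  simp [partialTrace_apply, contractWith, mul_apply, Fintype.sum_prod_type, kroneckerMap_apply,
    maxEntangled, one_apply, ite_and, Finset.mul_sum]
  rw [Finset.sum_comm]
  refine Finset.sum_congr rfl fun b _ => Finset.sum_congr rfl fun d _ => ?_
  field_simp

theorem trace_genTransposition {A : Type*} [Fintype A] [DecidableEq A] (W : Op (A × A))
    (N : LMap A A) (ρ : Op A) :
    (genTransposition W N ρ).trace =
      (choiMatrix N * (Wᴴ * ((1 : Op A) ⊗ₖ ρᵀ) * W)).trace := by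
  have h : (genTransposition W N ρ).trace =
      ((W * choiMatrix N * Wᴴ) * ((1 : Op A) ⊗ₖ ρᵀ)).trace := by
    simp [trace, Matrix.mul_apply (N := (1 : Op A) ⊗ₖ ρᵀ), genTransposition_apply_apply,
      kroneckerMap_apply,
      Fintype.sum_prod_type, one_apply]
  rw [h, Matrix.mul_assoc, Matrix.mul_assoc, Matrix.trace_mul_comm]
  simp only [Matrix.mul_assoc]

theorem trace_choiMatrix_mul_one_kronecker {X Y : Type*} [Fintype X] [DecidableEq X] [Fintype Y]
    [DecidableEq Y] (N : LMap X Y) (τ : Op X) :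
    (choiMatrix N * ((1 : Op Y) ⊗ₖ τᵀ)).trace = (N τ).trace := by
  simp [trace, mul_apply, apply_eq_sum_choiMatrix, Fintype.sum_prod_type, one_apply]

theorem trace_onPart_statePreparation_comp {A R S : Type*} [Fintype A] [DecidableEq A] [Fintype R]
    [DecidableEq R] [Fintype S] (Ψ : SMap A A A A) (σ : Op A) (N : LMap (A × R) (A × S))
    (ω : Op (Unit × R)) :
    (SMap.onPart (statePreparation σ ∘ₗ Ψ) N ω).trace =
      ∑ r, ∑ r', ω ((), r) ((), r') * ∑ s, (Ψ (N.component r r' s s) σ).trace := by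
  simp only [trace, diag_apply, SMap.onPart_apply, statePreparation_comp_apply, block_apply]
  rw [Finset.sum_comm]
  refine Finset.sum_congr rfl fun r _ => ?_
  rw [Finset.sum_comm]
  refine Finset.sum_congr rfl fun r' _ => ?_
  rw [Fintype.sum_prod_type, Finset.sum_comm, Finset.mul_sum]
  simp [Finset.mul_sum]

/-- Summing over `s` completes the output trace, so trace preservation applies to `τ ⊗ |r⟩⟨r'|`,
which is traceless for `r ≠ r'`. -/
theorem sum_trace_component {X Y R S : Type*} [Fintype X] [Fintype Y] [Fintype R]
    [DecidableEq R] [Fintype S] {N : LMap (X × R) (Y × S)}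
    (hN : ∀ ρ, (N ρ).trace = ρ.trace) (τ : Op X) (r r' : R) :
    ∑ s, (N.component r r' s s τ).trace = if r = r' then τ.trace else 0 := by
  have h := hN (τ ⊗ₖ single r r' 1)
  rw [trace_kronecker] at h
  simp only [trace, diag_apply, Fintype.sum_prod_type, single_apply, LMap.component_apply] at h ⊢
  rw [Finset.sum_comm, h]
  split_ifs with hr
  · simp [hr]
  · rw [Finset.sum_eq_zero (s := Finset.univ) (f := fun x : R => _)]
    · simp
    · rintro i -
      rw [if_neg]
      rintro ⟨rfl, rfl⟩
      exact hr rfl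

/-! ### Sufficiency of the intertwining relation -/

theorem isCompletelyPositive_onPart_statePreparation_comp_genTransposition {A R S : Type*}
    [Fintype A] [DecidableEq A] [Fintype R] [DecidableEq R] [Fintype S] [DecidableEq S]
    (W : Op (A × A)) {σ : Op A} (hσ : σ.PosSemidef) {N : LMap (A × R) (A × S)}
    (hN : IsCompletelyPositive N) :
    IsCompletelyPositive (SMap.onPart (statePreparation σ ∘ₗ genTransposition Wᴴ) N) := by
  intro k ω hω
  let f : (R × A × A × A) × S × Fin k →
      ((A × S) × (A × R)) × ((Unit × R) × Fin k) × A := fun p =>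
    (((p.1.2.2.1, p.2.1), (p.1.2.2.2, p.1.1)), ((((), p.1.1), p.2.2), p.1.2.1))
  -- An index `i = (r, b, p)` holds the ancilla input `r`, the index `b` contracted with `σ`, and
  -- the summation index `p` of the product with `W`. The output is the compression of `choiMatrix N
  -- ⊗ ω ⊗ σ` by `V`; unitarity of `W` plays no role.
  let V : Matrix (R × A × A × A) A ℂ := Matrix.of fun i y => W i.2.2 (y, i.2.1)
  convert (posSemidef_compress
    ((hN.posSemidef_choiMatrix.kronecker (hω.kronecker hσ)).submatrix f) V).submatrix
    (fun p : (A × S) × Fin k => (p.1.1, (p.1.2, p.2))) using 1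
  ext ⟨⟨y, s⟩, l⟩ ⟨⟨y', s'⟩, l'⟩
  have hC : ∀ r r' (p p' : A × A), choiMatrix (N.component r r' s s') p p' =
      choiMatrix N ((p.1, s), (p.2, r)) ((p'.1, s'), (p'.2, r')) := by
    intro r r' p p'
    simp only [choiMatrix, of_apply, LMap.component_apply]
    rw [single_kronecker_single, one_mul]
  simp only [LMap.tensorId_apply, SMap.onPart_apply, statePreparation_comp_apply, block_apply,
    genTransposition_apply_apply, conjTranspose_conjTranspose, Matrix.mul_apply,
    conjTranspose_apply, hC, submatrix_apply, of_apply, kroneckerMap_apply, V, f]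
  rw [Fintype.sum_prod_type]
  refine Finset.sum_congr rfl fun r _ => ?_
  rw [Finset.sum_comm, Fintype.sum_prod_type]
  refine Finset.sum_congr rfl fun r' _ => ?_
  simp only [Fintype.sum_prod_type (α₁ := A) (α₂ := A × A), Finset.mul_sum, Finset.sum_mul]
  rw [Finset.sum_comm]
  refine Finset.sum_congr rfl fun d _ => ?_
  rw [Finset.sum_comm]
  refine Finset.sum_congr rfl fun q _ => Finset.sum_congr rfl fun b _ =>
    Finset.sum_congr rfl fun p _ => ?_
  ring

theorem isSuperchannel_of_conj_eq {A : Type*} [Fintype A] [DecidableEq A] (W : Op (A × A))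
    {σ τ : Op A} (hσ : IsState σ) (hτ : IsState τ)
    (h : W * ((1 : Op A) ⊗ₖ σᵀ) * Wᴴ = (1 : Op A) ⊗ₖ τᵀ) :
    IsSuperchannel (statePreparation σ ∘ₗ genTransposition Wᴴ) := by
  intro m n N hN
  refine ⟨isCompletelyPositive_onPart_statePreparation_comp_genTransposition W hσ.1 hN.1,
    fun ω => ?_⟩
  simp only [trace_onPart_statePreparation_comp, trace_genTransposition,
    conjTranspose_conjTranspose, h, trace_choiMatrix_mul_one_kronecker, sum_trace_component hN.2,
    hτ.2]
  simp [trace, Fintype.sum_prod_type]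

/-! ### Necessity: testing on a single channel -/

/-- The trace condition a superchannel imposes on the Choi matrices of channels. -/
theorem IsSuperchannel.trace_mul_eq_one {A : Type*} [Fintype A] [DecidableEq A]
    {W : Op (A × A)} {σ : Op A}
    (h : IsSuperchannel (statePreparation σ ∘ₗ genTransposition Wᴴ))
    {C : Op (A × A)} (hC : C.PosSemidef)
    (hC' : ∀ x x', ∑ a, C (a, x) (a, x') = if x = x' then 1 else 0) :
    (C * (W * ((1 : Op A) ⊗ₖ σᵀ) * Wᴴ)).trace = 1 := by
  let f : (A × Fin 1) × (A × Fin 1) → A × A := fun p => (p.1.1, p.2.1)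
  let N : LMap (A × Fin 1) (A × Fin 1) := ofChoiMatrix (C.submatrix f f)
  have hN : IsChannel N := by
    refine ⟨isCompletelyPositive_of_posSemidef_choiMatrix ?_, fun ρ => ?_⟩
    · rw [choiMatrix_ofChoiMatrix]
      exact hC.submatrix f
    · simp only [trace, diag_apply, N, ofChoiMatrix, LinearMap.coe_mk, AddHom.coe_mk, of_apply,
        f, submatrix_apply]
      rw [Finset.sum_comm]
      refine Finset.sum_congr rfl fun x _ => ?_
      rw [Finset.sum_comm]
      simp only [← Finset.sum_mul, Fintype.sum_prod_type (α₁ := A) (α₂ := Fin 1),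
        Finset.univ_unique, Finset.sum_singleton, hC']
      obtain ⟨x, i⟩ := x
      simp [Subsingleton.elim i default]
  have hc : choiMatrix (N.component 0 0 0 0) = C := by
    have h0 := choiMatrix_ofChoiMatrix (C.submatrix f f)
    ext p q
    have := congrFun₂ h0 ((p.1, 0), (p.2, 0)) ((q.1, 0), (q.2, 0))
    simp only [choiMatrix, of_apply, LMap.component_apply] at this ⊢
    rw [single_kronecker_single, one_mul]
    exact this
  -- With one-dimensional ancillas, the input `1` has trace one.
  have ht := (h 1 1 N hN).2 1
  rw [trace_onPart_statePreparation_comp] at ht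
  simpa [trace_genTransposition, hc] using ht

/-! ### Spectra and unitary similarity -/

theorem charpoly_one_kronecker {m n R : Type*} [CommRing R] [Fintype m] [DecidableEq m]
    [Fintype n] [DecidableEq n] (S : Matrix n n R) :
    ((1 : Matrix m m R) ⊗ₖ S).charpoly = S.charpoly ^ Fintype.card m := by
  have h : ((1 : Matrix m m R) ⊗ₖ S).charmatrix =
      (1 : Matrix m m (Polynomial R)) ⊗ₖ S.charmatrix := by
    ext1 ⟨i, j⟩ ⟨i', j'⟩
    by_cases hi : i = i' <;> by_cases hj : j = j' <;>
      simp [kroneckerMap_apply, one_apply, hi, hj]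
  rw [charpoly, h, det_kronecker, det_one, one_pow, one_mul, charpoly]

/-- Powers multiply root multiplicities by `k`, which cancels; a split monic polynomial is
determined by its roots. -/
theorem _root_.Matrix.IsHermitian.charpoly_eq_of_pow_eq {n : Type*} [Fintype n] [DecidableEq n]
    {S T : Matrix n n ℂ} (hS : S.IsHermitian) (hT : T.IsHermitian) {k : ℕ} (hk : k ≠ 0)
    (h : S.charpoly ^ k = T.charpoly ^ k) : S.charpoly = T.charpoly := by
  have hr : S.charpoly.roots = T.charpoly.roots := by
    have := congrArg Polynomial.roots h
    rw [Polynomial.roots_pow, Polynomial.roots_pow] at this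
    ext z
    have := congrArg (Multiset.count z) this
    rw [Multiset.count_nsmul, Multiset.count_nsmul] at this
    exact Nat.eq_of_mul_eq_mul_left (Nat.pos_of_ne_zero hk) this
  rw [hS.splits_charpoly.eq_prod_roots_of_monic S.charpoly_monic, hr,
    ← hT.splits_charpoly.eq_prod_roots_of_monic T.charpoly_monic]

theorem _root_.Matrix.IsHermitian.exists_unitary_conj_eq {n : Type*} [Fintype n] [DecidableEq n]
    {S T : Matrix n n ℂ} (hS : S.IsHermitian) (hT : T.IsHermitian)
    (h : S.charpoly = T.charpoly) : ∃ U ∈ unitaryGroup n ℂ, T = U * S * Uᴴ := by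
  have he := (hS.eigenvalues_eq_eigenvalues_iff hT).2 h
  -- Diagonalize `S`, then undo the diagonalization of `T`; the two diagonal matrices agree.
  refine ⟨(hT.eigenvectorUnitary * star hS.eigenvectorUnitary : unitaryGroup n ℂ),
    Subtype.property _, ?_⟩
  have h1 := hS.conjStarAlgAut_star_eigenvectorUnitary
  have h2 := hT.spectral_theorem
  rw [← he, ← h1, Unitary.conjStarAlgAut_apply, Unitary.conjStarAlgAut_apply] at h2
  refine h2.trans ?_
  simp [← star_eq_conjTranspose, Matrix.mul_assoc]

/-! ### Rigidity of operators with constant trace against channels -/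

/-- By rescaling, the quadratic form of `X` vanishes on all vectors; over `ℂ`, polarization gives `X
= 0`. -/
theorem eq_zero_of_trace_vecMulVec_mul_eq_zero {n : Type*} [Fintype n] [DecidableEq n]
    {X : Matrix n n ℂ}
    (h : ∀ v : n → ℂ, star v ⬝ᵥ v = 1 → (vecMulVec v (star v) * X).trace = 0) : X = 0 := by
  have h' : ∀ v : n → ℂ, star v ⬝ᵥ (X *ᵥ v) = 0 := by
    intro v
    by_cases hv : v = 0
    · simp [hv]
    have hpos : 0 < star v ⬝ᵥ v := dotProduct_star_self_pos_iff.2 hv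
    obtain ⟨r, hr, hrv⟩ := RCLike.pos_iff_exists_ofReal.1 hpos
    have hc : ((√r)⁻¹ : ℂ) * (√r)⁻¹ * r = 1 := by
      have h0 : √r ≠ 0 := (Real.sqrt_pos.2 hr).ne'
      have h1 : (√r)⁻¹ * (√r)⁻¹ * r = 1 := by
        nth_rw 3 [← Real.mul_self_sqrt hr.le]
        field_simp
      exact_mod_cast h1
    have h1 := h (((√r)⁻¹ : ℂ) • v) (by simp [← hrv, ← hc, mul_assoc])
    simpa [vecMulVec_mul, trace_vecMulVec, dotProduct_comm v, ← dotProduct_mulVec,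
      (Real.sqrt_pos.2 hr).ne'] using h1
  have := (inner_map_self_eq_zero (toEuclideanLin X)).1 fun x => by
    rw [← inner_conj_symm, EuclideanSpace.inner_eq_star_dotProduct, dotProduct_comm]
    simp [toLpLin_apply, h']
  simpa using this

theorem posSemidef_one_sub_vecMulVec {n : Type*} [Fintype n] [DecidableEq n] {w : n → ℂ}
    (hw : star w ⬝ᵥ w = 1) : (1 - vecMulVec w (star w)).PosSemidef := by
  have h : (1 - vecMulVec w (star w))ᴴ * (1 - vecMulVec w (star w)) = 1 - vecMulVec w (star w) := by
    simp [conjTranspose_sub, conjTranspose_vecMulVec, sub_mul, mul_sub, vecMulVec_mul_vecMulVec, hw]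
  exact h ▸ posSemidef_conjTranspose_mul_self _

/-- Changing only the state prepared on one measurement outcome `w` cannot change the trace against
`M`. Hence contracting the second factor of `M` with any `|w⟩⟨w|` leaves a scalar operator, so
off-diagonal blocks vanish and diagonal blocks agree. -/
theorem exists_eq_one_kronecker {A : Type*} [Fintype A] [DecidableEq A] (a₀ : A)
    {M : Op (A × A)}
    (h : ∀ C : Op (A × A), C.PosSemidef →
      (∀ x x', ∑ a, C (a, x) (a, x') = if x = x' then 1 else 0) → (C * M).trace = 1) :
    M = (1 : Op A) ⊗ₖ M.submatrix (Prod.mk a₀) (Prod.mk a₀) := by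
  let blk : A → A → Op A := fun a a' => M.submatrix (Prod.mk a) (Prod.mk a')
  have htr : ∀ v : A → ℂ, star v ⬝ᵥ v = 1 → (vecMulVec v (star v)).trace = 1 := fun v hv => by
    rw [trace_vecMulVec, dotProduct_comm, hv]
  have hconst : ∀ w : A → ℂ, star w ⬝ᵥ w = 1 → ∃ c : ℂ, ∀ v : A → ℂ, star v ⬝ᵥ v = 1 →
      ((vecMulVec v (star v) ⊗ₖ vecMulVec w (star w)) * M).trace = c := by
    intro w hw
    let v₀ : A → ℂ := Pi.single a₀ 1
    have hv₀ : star v₀ ⬝ᵥ v₀ = 1 := by simp [v₀]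
    -- The test channel measures `{|w⟩⟨w|, 1 - |w⟩⟨w|}` and prepares `v` or the fixed `v₀`; the
    -- second term does not involve `v`.
    refine ⟨1 - ((vecMulVec v₀ (star v₀) ⊗ₖ (1 - vecMulVec w (star w))) * M).trace,
      fun v hv => ?_⟩
    rw [eq_sub_iff_add_eq, ← trace_add, ← Matrix.add_mul]
    refine h _ (((posSemidef_vecMulVec_self_star v).kronecker
      (posSemidef_vecMulVec_self_star w)).add ((posSemidef_vecMulVec_self_star v₀).kronecker
      (posSemidef_one_sub_vecMulVec hw))) fun x x' => ?_
    have h1 := htr v hv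
    have h2 := htr v₀ hv₀
    simp only [trace, diag_apply] at h1 h2
    simp only [Matrix.add_apply, kroneckerMap_apply, Finset.sum_add_distrib, ← Finset.sum_mul, h1,
      h2, Matrix.sub_apply, one_apply]
    ring
  have hblk : ∀ a a', blk a a' = if a = a' then blk a₀ a₀ else 0 := by
    intro a a'
    rw [← sub_eq_zero]
    refine eq_zero_of_trace_vecMulVec_mul_eq_zero fun w hw => ?_
    obtain ⟨c, hc⟩ := hconst w hw
    -- `M` contracted with `|w⟩⟨w|` on the second factor; its expectation in every unit vector `v`
    -- is `c`.
    let Mw : Op A := Matrix.of fun a a' => (vecMulVec w (star w) * blk a a').trace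
    have hMw : Mw - c • 1 = 0 := by
      refine eq_zero_of_trace_vecMulVec_mul_eq_zero fun v hv => ?_
      rw [Matrix.mul_sub, trace_sub, Matrix.mul_smul, Matrix.mul_one, trace_smul, htr v hv,
        ← hc v hv, smul_eq_mul, mul_one, sub_eq_zero]
      simp only [trace, diag_apply, Matrix.mul_apply, kroneckerMap_apply, Fintype.sum_prod_type,
        Mw, of_apply, blk, submatrix_apply, Finset.mul_sum]
      refine Finset.sum_congr rfl fun i _ => ?_
      rw [Finset.sum_comm]
      simp only [mul_assoc]
    have hMw' : ∀ a a', (vecMulVec w (star w) * blk a a').trace = if a = a' then c else 0 := by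
      intro a a'
      have := congrFun₂ (sub_eq_zero.1 hMw) a a'
      simpa [Mw, one_apply] using this
    rw [Matrix.mul_sub, trace_sub, hMw']
    split_ifs
    · simp [hMw']
    · simp
  ext ⟨a, b⟩ ⟨a', b'⟩
  have := congrFun₂ (hblk a a') b b'
  by_cases ha : a = a' <;> simpa [blk, ha, kroneckerMap_apply, one_apply] using this

end QuantumTime

theorem mainTheorem5 {A : Type*} [Fintype A] [DecidableEq A]
    (W : Matrix (A × A) (A × A) ℂ) (hW : W ∈ Matrix.unitaryGroup (A × A) ℂ)
    (σ : Matrix A A ℂ) (hσ : QuantumTime.IsState σ) :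
    (QuantumTime.IsSuperchannel (QuantumTime.statePreparation σ ∘ₗ QuantumTime.genTransposition Wᴴ) ↔
      ∃ τ : Matrix A A ℂ, QuantumTime.IsState τ ∧
        W * ((1 : Matrix A A ℂ) ⊗ₖ σᵀ) = ((1 : Matrix A A ℂ) ⊗ₖ τᵀ) * W) ∧
    (∀ τ : Matrix A A ℂ, QuantumTime.IsState τ →
      W * ((1 : Matrix A A ℂ) ⊗ₖ σᵀ) = ((1 : Matrix A A ℂ) ⊗ₖ τᵀ) * W →
      ∃ U ∈ Matrix.unitaryGroup A ℂ, τ = U * σ * Uᴴ) := by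
  have hW1 : W * Wᴴ = 1 := Matrix.mem_unitaryGroup_iff.1 hW
  have hW2 : Wᴴ * W = 1 := Matrix.mem_unitaryGroup_iff'.1 hW
  -- On an empty index set every trace is zero, so no state exists.
  obtain ⟨a₀⟩ : Nonempty A := by
    by_contra hA
    rw [not_nonempty_iff] at hA
    simpa [Matrix.trace] using hσ.2
  have hA : (Fintype.card A : ℂ) ≠ 0 := by
    have : Nonempty A := ⟨a₀⟩
    exact_mod_cast Fintype.card_ne_zero
  have hconj : ∀ τ : Matrix A A ℂ,
      W * ((1 : Matrix A A ℂ) ⊗ₖ σᵀ) = ((1 : Matrix A A ℂ) ⊗ₖ τᵀ) * W →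
      W * ((1 : Matrix A A ℂ) ⊗ₖ σᵀ) * Wᴴ = (1 : Matrix A A ℂ) ⊗ₖ τᵀ := fun τ h => by
    rw [h, Matrix.mul_assoc, hW1, Matrix.mul_one]
  refine ⟨⟨fun h => ?_, ?_⟩, fun τ hτ h => ?_⟩
  · have hM := QuantumTime.exists_eq_one_kronecker a₀ fun C hC hC' => h.trace_mul_eq_one hC hC'
    have hpos : (W * ((1 : Matrix A A ℂ) ⊗ₖ σᵀ) * Wᴴ).PosSemidef :=
      (Matrix.PosSemidef.one.kronecker hσ.1.transpose).mul_mul_conjTranspose_same W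
    have htr : (W * ((1 : Matrix A A ℂ) ⊗ₖ σᵀ) * Wᴴ).trace = Fintype.card A := by
      rw [Matrix.trace_mul_comm, ← Matrix.mul_assoc, hW2, Matrix.one_mul, Matrix.trace_kronecker,
        Matrix.trace_transpose, hσ.2, Matrix.trace_one, mul_one]
    set T := (W * ((1 : Matrix A A ℂ) ⊗ₖ σᵀ) * Wᴴ).submatrix (Prod.mk a₀) (Prod.mk a₀)
    have hTpos : T.PosSemidef := hpos.submatrix _
    refine ⟨Tᵀ, ⟨hTpos.transpose, ?_⟩, ?_⟩
    · rw [hM, Matrix.trace_kronecker, Matrix.trace_one] at htr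
      rw [Matrix.trace_transpose]
      exact mul_left_cancel₀ hA (htr.trans (mul_one _).symm)
    · rw [Matrix.transpose_transpose, ← hM, Matrix.mul_assoc, hW2, Matrix.mul_one]
  · rintro ⟨τ, hτ, h⟩
    exact QuantumTime.isSuperchannel_of_conj_eq W hσ hτ (hconj τ h)
  · have hc := congrArg Matrix.charpoly (hconj τ h)
    rw [Matrix.charpoly_mul_comm, ← Matrix.mul_assoc, hW2, Matrix.one_mul,
      QuantumTime.charpoly_one_kronecker, QuantumTime.charpoly_one_kronecker,
      Matrix.charpoly_transpose, Matrix.charpoly_transpose] at hc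
    exact hσ.1.isHermitian.exists_unitary_conj_eq hτ.1.isHermitian
      (hσ.1.isHermitian.charpoly_eq_of_pow_eq hτ.1.isHermitian
        (by exact_mod_cast hA) hc)
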